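/- Let $\gamma\in(0,1)$ and let $(\alpha_n)_{n\ge 0}$ be a sequence in the open unit disk $\mathbb D$ with infinitely many non-zero terms and $$\sum_{n=0}^\infty n^\gamma|\alpha_n|^2<\infty .$$ For $\beta\in[0,2\pi)$ let $\Phi_n(\cdot,\beta)$ be the monic polynomials with Verblunsky coefficients $e^{i\beta}\alpha_n$, that is, $\Phi_0(z,\beta)=1$ and $$\Phi_{n+1}(z,\beta)=z\,\Phi_n(z,\beta)-\overline{e^{i\beta}\alpha_n}\,\Phi_n^*(z,\beta),\qquad \Phi_n^*(z,\beta)=z^n\,\overline{\Phi_n(1/\overline z,\beta)},$$ and let $R_n(\eta,\beta)=|\Phi_n(e^{i\eta},\beta)|$ be the Prüfer radius. Define $x_0=0$ and, for $n\ge 0$, let $x_{n+1}$ be the smallest power of $2$ (with $1=2^0$ counted as a power of $2$) such that $x_{n+1}>x_n$ and $\alpha_j\ne 0$ for at least one integer $j\in[x_n,x_{n+1})$. Let $\nu$ be a finite Borel measure on $(0,2\pi)$ such that (i) there is $\delta>0$ such that $\nu$ is supported by $(\delta,2\pi-\delta)$, i.e. the complement of this interval is $\nu$-null; (ii) there are $D\in(1-\gamma,1)$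 and $C<\infty$ such that $\nu(I)\le C|I|^D$ for every interval $I\subseteq(0,2\pi)$. Then, for $\nu$-almost every $\eta$, $$\sup\{R_{x_n}(\eta,\beta):\ \beta\in[0,2\pi),\ n\in\mathbb Z_{\ge 0}\}<\infty .$$ -/

import Mathlib

namespace OPUC

/-- The Szegő dual at degree `n`: for `P` of degree at most `n` this is the polynomial
`z ^ n * conj (P (1 / conj z))`. -/
noncomputable def szegoDual (n : ℕ) (P : Polynomial ℂ) : Polynomial ℂ :=
  (P.map (starRingEnd ℂ)).reflect n

/-- The monic orthogonal polynomials with Verblunsky coefficients `a`, through the Szegő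
recurrence `Φ_{n+1}(z) = z Φ_n(z) - conj (a_n) Φ_n^*(z)`, `Φ_0 = 1`. -/
noncomputable def monicOPUC (a : ℕ → ℂ) : ℕ → Polynomial ℂ
  | 0 => 1
  | n + 1 =>
      Polynomial.X * monicOPUC a n
        - Polynomial.C (starRingEnd ℂ (a n)) * szegoDual n (monicOPUC a n)

/-- The monic polynomials `Φ_n(·, β)`, with Verblunsky coefficients `e^{iβ} α_n`. -/
noncomputable def monicOPUCPhase (α : ℕ → ℂ) (β : ℝ) (n : ℕ) : Polynomial ℂ :=
  monicOPUC (fun k => Complex.exp (Complex.I * β) * α k) n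

/-- The Prüfer radius `R_n(η, β)`. In the polar form
`Φ_n(e^{iη}, β) = R_n(η, β) exp (i (n η + θ_n(η, β)))` with `θ_n` real and `R_n > 0`,
it is the modulus of the left-hand side. -/
noncomputable def pruferRadius (α : ℕ → ℂ) (n : ℕ) (η β : ℝ) : ℝ :=
  ‖(monicOPUCPhase α β n).eval (Complex.exp (Complex.I * η))‖

/-- The admissible right endpoints for a block starting at `x`: powers of two `m > x` such that
`α j ≠ 0` for at least one `j ∈ [x, m)`. -/
def blockCandidates (α : ℕ → ℂ) (x : ℕ) : Set ℕ :=
  {m | (∃ k : ℕ, m = 2 ^ k) ∧ x < m ∧ ∃ j ∈ Set.Ico x m, α j ≠ 0}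

/-- The dyadic block endpoints: `x_0 = 0`, and `x_{n+1}` is the smallest power of two
`m > x_n` such that `α j ≠ 0` for at least one `j ∈ [x_n, m)`. -/
noncomputable def blockEndpoint (α : ℕ → ℂ) : ℕ → ℕ
  | 0 => 0
  | n + 1 => sInf (blockCandidates α (blockEndpoint α n))

/-- If `α` is not finitely supported, the minimum defining `blockEndpoint` is attained. -/
theorem blockEndpoint_isLeast (α : ℕ → ℂ) (hα : {n | α n ≠ 0}.Infinite) (n : ℕ) :
    IsLeast (blockCandidates α (blockEndpoint α n)) (blockEndpoint α (n + 1)) := by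
  have hne : (blockCandidates α (blockEndpoint α n)).Nonempty := by
    obtain ⟨j, hj, hjx⟩ := hα.exists_gt (blockEndpoint α n)
    have h2 : j < 2 ^ j := Nat.lt_two_pow_self
    exact ⟨2 ^ j, ⟨j, rfl⟩, hjx.trans h2, j, ⟨hjx.le, h2⟩, hj⟩
  exact ⟨Nat.sInf_mem hne, fun m hm => Nat.sInf_le hm⟩

end OPUC

/-! On the unit circle `v_n = e^{iβ/2} e^{-inη} Φ_n(e^{iη}, β)` satisfies `v_{n+1} = v_n + c_n conj
v_n` with `c_n = -conj(α_n) e^{-i(n+1)η}`. This is a real-linear recursion on `ℂ` whose coefficients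
do not involve `β`; the phase enters only through the unit vector `v_0 = e^{iβ/2}`. The operator
norm of the transfer product therefore bounds all `β` at once (`pruferRadius_le`), and since every
`x_n` is `0` or a power of two, it suffices to bound these products along powers of two for almost
every `η`.

The product over `[2^k, 2^{k+1})` differs from `1` by at most the norm of the sum of its steps plus
three times the sum of squared dyadic subblock sums, once the latter is below a multiple of
`1/(k+1)` (`norm_orderedProd_sub_one_le`). These sums are trigonometric polynomials in `η`. A
Sobolev inequality at scale `1/N` and the Hölder bound on `ν` give `∫ |sum of N terms|² dν ≲ N^{1-D}
∑ |α_j|²`. Adding over about `k` dyadic levels, and using `∑ |α_j|² ≲ 2^{-kγ}` on the block, the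
expected energy is `O((k+1) 2^{-k(D+γ-1)})`. Since `D > 1 - γ` this decays geometrically, hence so
does the energy at almost every `η` (`ae_exists_forall_le_mul_pow`). The block products are then
summably close to `1`, and their product stays bounded. -/

namespace OPUC

/-! ### Noncommutative products near the identity, controlled dyadically. -/

section OrderedProduct

variable {𝔸 : Type*} [NormedRing 𝔸]

/-- The ordered product `(1 + B (s + n - 1)) * ⋯ * (1 + B s)`. -/
def orderedProd (B : ℕ → 𝔸) (s : ℕ) : ℕ → 𝔸
  | 0 => 1
  | n + 1 => (1 + B (s + n)) * orderedProd B s n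

/-- The sum of `B` over `[s, s + n)`. -/
def blockSum {M : Type*} [AddCommMonoid M] (B : ℕ → M) (s n : ℕ) : M :=
  ∑ i ∈ Finset.range n, B (s + i)

theorem orderedProd_add (B : ℕ → 𝔸) (s m n : ℕ) :
    orderedProd B s (m + n) = orderedProd B (s + m) n * orderedProd B s m := by
  induction n with
  | zero => simp [orderedProd]
  | succ n ih => rw [← add_assoc, orderedProd, ih, orderedProd, mul_assoc, add_assoc]

theorem blockSum_add {M : Type*} [AddCommMonoid M] (B : ℕ → M) (s m n : ℕ) :
    blockSum B s (m + n) = blockSum B s m + blockSum B (s + m) n := by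
  simp [blockSum, Finset.sum_range_add, add_assoc]

/-- The sum of the squared norms of the sums of `B` over all dyadic proper subintervals of
`[s, s + 2 ^ m)`. -/
def dyadicEnergy {M : Type*} [SeminormedAddCommGroup M] (B : ℕ → M) : ℕ → ℕ → ℝ
  | 0, _ => 0
  | m + 1, s => ‖blockSum B s (2 ^ m)‖ ^ 2 + ‖blockSum B (s + 2 ^ m) (2 ^ m)‖ ^ 2
      + dyadicEnergy B m s + dyadicEnergy B m (s + 2 ^ m)

theorem dyadicEnergy_nonneg {M : Type*} [SeminormedAddCommGroup M] (B : ℕ → M) (m s : ℕ) :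
    0 ≤ dyadicEnergy B m s := by
  induction m generalizing s with
  | zero => simp [dyadicEnergy]
  | succ m ih =>
    have h1 := ih s
    have h2 := ih (s + 2 ^ m)
    simp only [dyadicEnergy]
    positivity

/-- If the dyadic energy is small then the ordered product is well approximated by its
linearization. -/
theorem norm_orderedProd_sub_linearization_le (B : ℕ → 𝔸) {ε : ℝ} (hε : 0 ≤ ε) (m s : ℕ)
    (h : (1 + ε) ^ m * dyadicEnergy B m s ≤ ε) :
    ‖orderedProd B s (2 ^ m) - 1 - blockSum B s (2 ^ m)‖ ≤ (1 + ε) ^ m * dyadicEnergy B m s := by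
  induction m generalizing s with
  -- A single factor equals its linearization, so the energy need only count proper subintervals.
  | zero => simp [orderedProd, blockSum, dyadicEnergy]
  | succ m ih =>
    set t := s + 2 ^ m with ht
    have hEl := dyadicEnergy_nonneg B m s
    have hEr := dyadicEnergy_nonneg B m t
    have hp : (1 : ℝ) ≤ (1 + ε) ^ m := one_le_pow₀ (by linarith)
    have hp' : (1 + ε) ^ m ≤ (1 + ε) ^ (m + 1) := pow_le_pow_right₀ (by linarith) (by omega)
    have hE : dyadicEnergy B (m + 1) s = ‖blockSum B s (2 ^ m)‖ ^ 2
      + ‖blockSum B t (2 ^ m)‖ ^ 2 + dyadicEnergy B m s + dyadicEnergy B m t := rfl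
    have hsum := blockSum_add B s (2 ^ m) (2 ^ m)
    have hprod := orderedProd_add B s (2 ^ m) (2 ^ m)
    rw [← ht] at hsum hprod
    have hEsub : ∀ e : ℝ, 0 ≤ e → e ≤ dyadicEnergy B (m + 1) s → (1 + ε) ^ m * e ≤ ε :=
      fun e he hle => (mul_le_mul hp' hle he (by positivity)).trans h
    have hl' := hEsub _ hEl (by
      rw [hE]; linarith [sq_nonneg ‖blockSum B s (2 ^ m)‖, sq_nonneg ‖blockSum B t (2 ^ m)‖])
    have hr' := hEsub _ hEr (by
      rw [hE]; linarith [sq_nonneg ‖blockSum B s (2 ^ m)‖, sq_nonneg ‖blockSum B t (2 ^ m)‖])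
    have hl := ih s hl'
    have hr := ih t hr'
    rw [pow_succ 2 m, mul_two, hsum, hprod, hE]
    set a := blockSum B s (2 ^ m)
    set b := blockSum B t (2 ^ m)
    set wl := orderedProd B s (2 ^ m) - 1 - a with hwl
    set wr := orderedProd B t (2 ^ m) - 1 - b with hwr
    -- With each half written as `1 + sum + error`, the new error is the sum of the old errors plus
    -- one cross product.
    have key : orderedProd B t (2 ^ m) * orderedProd B s (2 ^ m) - 1 - (a + b)
        = wr + wl + (b + wr) * (a + wl) := by
      have e1 : orderedProd B s (2 ^ m) = 1 + a + wl := by rw [hwl]; abel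
      have e2 : orderedProd B t (2 ^ m) = 1 + b + wr := by rw [hwr]; abel
      rw [e1, e2]; noncomm_ring
    rw [key]
    have n1 : ‖wr + wl + (b + wr) * (a + wl)‖
        ≤ ‖wr‖ + ‖wl‖ + (‖b‖ + ‖wr‖) * (‖a‖ + ‖wl‖) :=
      (norm_add_le _ _).trans (add_le_add (norm_add_le _ _) ((norm_mul_le _ _).trans
        (mul_le_mul (norm_add_le _ _) (norm_add_le _ _) (norm_nonneg _) (by positivity))))
    -- By induction the errors are at most `ε`, so their squares are absorbed linearly; each level
    -- then costs a factor `1 + ε`.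
    have hwl1 : ‖wl‖ ^ 2 ≤ ε * ‖wl‖ := by nlinarith [norm_nonneg wl]
    have hwr1 : ‖wr‖ ^ 2 ≤ ε * ‖wr‖ := by nlinarith [norm_nonneg wr]
    have n2 : (‖b‖ + ‖wr‖) * (‖a‖ + ‖wl‖) ≤ ‖a‖ ^ 2 + ‖b‖ ^ 2 + ‖wl‖ ^ 2 + ‖wr‖ ^ 2 := by
      nlinarith [sq_nonneg (‖b‖ + ‖wr‖ - (‖a‖ + ‖wl‖)), sq_nonneg (‖a‖ - ‖wl‖),
        sq_nonneg (‖b‖ - ‖wr‖)]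
    have n3 : ‖a‖ ^ 2 + ‖b‖ ^ 2 ≤ (1 + ε) ^ (m + 1) * (‖a‖ ^ 2 + ‖b‖ ^ 2) :=
      le_mul_of_one_le_left (by positivity) (hp.trans hp')
    have n4 : (1 + ε) * (‖wl‖ + ‖wr‖)
        ≤ (1 + ε) ^ (m + 1) * (dyadicEnergy B m s + dyadicEnergy B m t) := by
      rw [pow_succ', mul_assoc]
      exact mul_le_mul_of_nonneg_left (by linarith) (by linarith)
    nlinarith

/-- If the dyadic energy is small then the ordered product is close to `1`, with an absolute constant. -/
theorem norm_orderedProd_sub_one_le (B : ℕ → 𝔸) (m s : ℕ)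
    (h : 3 * dyadicEnergy B m s ≤ 1 / ((m : ℝ) + 1)) :
    ‖orderedProd B s (2 ^ m) - 1‖ ≤ ‖blockSum B s (2 ^ m)‖ + 3 * dyadicEnergy B m s := by
  have hE := dyadicEnergy_nonneg B m s
  -- The choice `ε = 1/(m+1)` keeps the accumulated loss over `m` levels below `e < 3`.
  have hpow : (1 + 1 / ((m : ℝ) + 1)) ^ m ≤ 3 := by
    have h1 : (1 + 1 / ((m : ℝ) + 1)) ^ m ≤ Real.exp (1 / ((m : ℝ) + 1)) ^ m :=
      pow_le_pow_left₀ (by positivity) (by linarith [Real.add_one_le_exp (1 / ((m : ℝ) + 1))]) m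
    rw [← Real.exp_nat_mul] at h1
    have h2 : (m : ℝ) * (1 / ((m : ℝ) + 1)) ≤ 1 := by
      rw [mul_one_div, div_le_one (by positivity)]; linarith
    have h3 := Real.exp_le_exp.2 h2
    linarith [Real.exp_one_lt_three]
  have hle := mul_le_mul_of_nonneg_right hpow hE
  have h0 := norm_orderedProd_sub_linearization_le B (ε := 1 / ((m : ℝ) + 1)) (by positivity) m s
    (hle.trans h)
  calc ‖orderedProd B s (2 ^ m) - 1‖
      = ‖(orderedProd B s (2 ^ m) - 1 - blockSum B s (2 ^ m)) + blockSum B s (2 ^ m)‖ := by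
        rw [sub_add_cancel]
    _ ≤ _ := norm_add_le _ _
    _ ≤ _ := by linarith

/-- A discrete Grönwall bound: each step multiplies the norm by at most `1 + ‖T k - 1‖ ≤ exp ‖T k -
1‖`. -/
theorem bddAbove_norm_of_summable_norm_sub_one (P T : ℕ → 𝔸)
    (hP : ∀ k, P (k + 1) = T k * P k) (hT : Summable fun k => ‖T k - 1‖) :
    ∃ C, ∀ k, ‖P k‖ ≤ C := by
  refine ⟨Real.exp (∑' k, ‖T k - 1‖) * ‖P 0‖, fun k => ?_⟩
  have h : ‖P k‖ ≤ Real.exp (∑ i ∈ Finset.range k, ‖T i - 1‖) * ‖P 0‖ := by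
    induction k with
    | zero => simp
    | succ k ih =>
      have e : P (k + 1) = P k + (T k - 1) * P k := by rw [hP]; noncomm_ring
      calc ‖P (k + 1)‖ ≤ ‖P k‖ + ‖T k - 1‖ * ‖P k‖ := by
            rw [e]
            exact (norm_add_le _ _).trans (add_le_add le_rfl (norm_mul_le _ _))
        _ = (‖T k - 1‖ + 1) * ‖P k‖ := by ring
        _ ≤ Real.exp ‖T k - 1‖ * (Real.exp (∑ i ∈ Finset.range k, ‖T i - 1‖) * ‖P 0‖) :=
            mul_le_mul (Real.add_one_le_exp _) ih (norm_nonneg _) (Real.exp_pos _).le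
        _ = _ := by rw [Finset.sum_range_succ, Real.exp_add]; ring
  refine h.trans (mul_le_mul_of_nonneg_right (Real.exp_le_exp.2 ?_) (norm_nonneg _))
  exact hT.sum_le_tsum _ fun _ _ => norm_nonneg _

end OrderedProduct

/-! ### The Szegő recurrence as a real-linear recursion independent of `β`. -/

section Pruefer

open Polynomial

theorem natDegree_monicOPUC_le (a : ℕ → ℂ) (n : ℕ) : (monicOPUC a n).natDegree ≤ n := by
  induction n with
  | zero => simp [monicOPUC]
  | succ n ih =>
    have h1 : (szegoDual n (monicOPUC a n)).natDegree ≤ n := by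
      refine natDegree_le_iff_coeff_eq_zero.2 fun N hN => ?_
      rw [szegoDual, coeff_reflect, revAt_eq_self_of_lt hN, coeff_map,
        coeff_eq_zero_of_natDegree_lt (ih.trans_lt hN), map_zero]
    refine (natDegree_sub_le _ _).trans (max_le ?_ ?_)
    · exact natDegree_mul_le.trans (by have := natDegree_X_le (R := ℂ); omega)
    · exact (natDegree_C_mul_le _ _).trans (h1.trans n.le_succ)

theorem eval_szegoDual {n : ℕ} {P : ℂ[X]} (hP : P.natDegree ≤ n) {z : ℂ} (hz : ‖z‖ = 1) :
    (szegoDual n P).eval z = z ^ n * starRingEnd ℂ (P.eval z) := by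
  have hz0 : z ≠ 0 := by rintro rfl; simp at hz
  have hinv : starRingEnd ℂ z = z⁻¹ := by
    rw [Complex.inv_def, Complex.normSq_eq_norm_sq, hz]; simp
  let _ : Invertible (z⁻¹) := invertibleOfNonzero (inv_ne_zero hz0)
  have h := eval₂_reflect_mul_pow (RingHom.id ℂ) (z⁻¹) n (P.map (starRingEnd ℂ))
    (natDegree_map_le.trans hP)
  have h2 : starRingEnd ℂ (P.eval z) = eval₂ (RingHom.id ℂ) (z⁻¹) (P.map (starRingEnd ℂ)) := by
    rw [← hinv, ← eval, eval_map, eval₂_hom]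
  rw [invOf_eq_inv, inv_inv] at h
  rw [h2, ← h, szegoDual, eval, inv_pow]
  field_simp

/-- The coefficients of the real-linear system satisfied by
`e^{iβ/2} e^{-inη} Φ_n(e^{iη}, β)`. -/
noncomputable def pruferCoeff (α : ℕ → ℂ) (η : ℝ) (n : ℕ) : ℂ :=
  -(starRingEnd ℂ (α n) * Complex.exp (-(Complex.I * η)) ^ (n + 1))

/-- The real-linear maps `v ↦ pruferCoeff α η n * conj v`. -/
noncomputable def pruferStep (α : ℕ → ℂ) (η : ℝ) (n : ℕ) : ℂ →L[ℝ] ℂ :=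
  pruferCoeff α η n • (Complex.conjCLE : ℂ →L[ℝ] ℂ)

theorem blockSum_pruferStep (α : ℕ → ℂ) (η : ℝ) (s n : ℕ) :
    blockSum (pruferStep α η) s n
      = blockSum (pruferCoeff α η) s n • (Complex.conjCLE : ℂ →L[ℝ] ℂ) := by
  ext1 v
  simp [blockSum, pruferStep, Finset.sum_mul]

theorem norm_blockSum_pruferStep (α : ℕ → ℂ) (η : ℝ) (s n : ℕ) :
    ‖blockSum (pruferStep α η) s n‖ = ‖blockSum (pruferCoeff α η) s n‖ := by
  rw [blockSum_pruferStep, norm_smul, Complex.conjCLE_norm, mul_one]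

theorem dyadicEnergy_pruferStep (α : ℕ → ℂ) (η : ℝ) (m s : ℕ) :
    dyadicEnergy (pruferStep α η) m s = dyadicEnergy (pruferCoeff α η) m s := by
  induction m generalizing s with
  | zero => rfl
  | succ m ih => simp only [dyadicEnergy, norm_blockSum_pruferStep, ih]

/-- Removing the rotation `e^{inη}` and splitting `β` in half moves all dependence on `β` into the
initial vector. -/
theorem eval_monicOPUCPhase (α : ℕ → ℂ) (η β : ℝ) (n : ℕ) :
    orderedProd (pruferStep α η) 0 n (Complex.exp (Complex.I * (β / 2)))
      = Complex.exp (Complex.I * (β / 2)) * Complex.exp (-(Complex.I * η)) ^ n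
        * (monicOPUCPhase α β n).eval (Complex.exp (Complex.I * η)) := by
  induction n with
  | zero => simp [orderedProd, monicOPUCPhase, monicOPUC]
  | succ n ih =>
    have hz : ‖Complex.exp (Complex.I * η)‖ = 1 := by
      rw [mul_comm]; exact Complex.norm_exp_ofReal_mul_I η
    have hstep : (monicOPUCPhase α β (n + 1)).eval (Complex.exp (Complex.I * η))
        = Complex.exp (Complex.I * η) * (monicOPUCPhase α β n).eval (Complex.exp (Complex.I * η))
          - starRingEnd ℂ (Complex.exp (Complex.I * β) * α n)
            * (Complex.exp (Complex.I * η) ^ n * starRingEnd ℂ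
              ((monicOPUCPhase α β n).eval (Complex.exp (Complex.I * η)))) := by
      have h : (monicOPUCPhase α β n).natDegree ≤ n := natDegree_monicOPUC_le _ n
      rw [← eval_szegoDual h hz]
      simp [monicOPUCPhase, monicOPUC]
    have hop : orderedProd (pruferStep α η) 0 (n + 1) (Complex.exp (Complex.I * (β / 2)))
        = orderedProd (pruferStep α η) 0 n (Complex.exp (Complex.I * (β / 2)))
          + pruferCoeff α η n * starRingEnd ℂ
            (orderedProd (pruferStep α η) 0 n (Complex.exp (Complex.I * (β / 2)))) := by
      simp [orderedProd, pruferStep]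
    have hc1 : starRingEnd ℂ (Complex.exp (-(Complex.I * η))) = Complex.exp (Complex.I * η) := by
      rw [← Complex.exp_conj]; simp
    -- Why half the phase: multiplying `e^{iβ/2}` by the conjugate of `e^{iβ}` gives `e^{-iβ/2}`,
    -- the conjugate of the initial vector.
    have hc2 : starRingEnd ℂ (Complex.exp (Complex.I * β))
        = Complex.exp (-(Complex.I * (β / 2))) ^ 2 := by
      rw [← Complex.exp_conj, ← Complex.exp_nat_mul]; simp; ring_nf
    have hc3 : starRingEnd ℂ (Complex.exp (Complex.I * (β / 2)))
        = Complex.exp (-(Complex.I * (β / 2))) := by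
      rw [← Complex.exp_conj]; simp [Complex.conj_ofNat]
    have hzi : Complex.exp (-(Complex.I * η)) * Complex.exp (Complex.I * η) = 1 := by
      rw [← Complex.exp_add]; simp
    have hbi : Complex.exp (Complex.I * (β / 2)) * Complex.exp (-(Complex.I * (β / 2))) = 1 := by
      rw [← Complex.exp_add]; simp
    rw [hop, ih, hstep, pruferCoeff]
    simp only [map_mul, map_pow, hc1, hc2, hc3]
    generalize Complex.exp (-(Complex.I * η)) = w at *
    generalize Complex.exp (Complex.I * η) = z at *
    generalize Complex.exp (-(Complex.I * (β / 2))) = b' at *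
    generalize Complex.exp (Complex.I * (β / 2)) = b at *
    generalize eval z (monicOPUCPhase α β n) = P at *
    linear_combination (-(b * w ^ n * P)) * hzi + starRingEnd ℂ (α n) * w ^ (n + 1) * z ^ n *
      b' * starRingEnd ℂ P * hbi

theorem pruferRadius_le (α : ℕ → ℂ) (n : ℕ) (η β : ℝ) :
    pruferRadius α n η β ≤ ‖orderedProd (pruferStep α η) 0 n‖ := by
  have h1 : ∀ x : ℝ, ‖Complex.exp (Complex.I * x)‖ = 1 := fun x => by
    rw [mul_comm]; exact Complex.norm_exp_ofReal_mul_I x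
  have hb : ‖Complex.exp (Complex.I * (β / 2))‖ = 1 := by simpa using h1 (β / 2)
  have hw : ‖Complex.exp (-(Complex.I * η))‖ = 1 := by simpa using h1 (-η)
  have h := (orderedProd (pruferStep α η) 0 n).le_opNorm (Complex.exp (Complex.I * (β / 2)))
  rw [eval_monicOPUCPhase, norm_mul, norm_mul, norm_pow, hb, hw] at h
  simpa [pruferRadius] using h

end Pruefer

end OPUC

namespace OPUC

/-! ### An `L²(ν)` bound for trigonometric polynomials. -/

section TrigPoly

open MeasureTheory intervalIntegral

/-- The trigonometric polynomial `∑_{n < N} a_n e^{-inx}`. -/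
noncomputable def trigPoly (a : ℕ → ℂ) (N : ℕ) (x : ℝ) : ℂ :=
  ∑ n ∈ Finset.range N, a n * Complex.exp (-(Complex.I * n) * x)

theorem hasDerivAt_trigPoly (a : ℕ → ℂ) (N : ℕ) (x : ℝ) :
    HasDerivAt (trigPoly a N) (trigPoly (fun n => -(Complex.I * n) * a n) N x) x := by
  have h : ∀ n ∈ Finset.range N,
      HasDerivAt (fun y : ℝ => a n * Complex.exp (-(Complex.I * n) * y))
        (-(Complex.I * n) * a n * Complex.exp (-(Complex.I * n) * x)) x := by
    intro n _
    have h1 : HasDerivAt (fun y : ℝ => -(Complex.I * n) * (y : ℂ)) (-(Complex.I * n)) x := by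
      simpa using (Complex.ofRealCLM.hasDerivAt (x := x)).const_mul (-(Complex.I * n))
    exact (h1.cexp.const_mul (a n)).congr_deriv (by ring)
  exact (HasDerivAt.fun_sum h)

theorem continuous_trigPoly (a : ℕ → ℂ) (N : ℕ) : Continuous (trigPoly a N) := by
  unfold trigPoly; fun_prop

theorem integral_exp_int_mul (k : ℤ) :
    ∫ x in (0 : ℝ)..2 * Real.pi, Complex.exp (Complex.I * k * x)
      = if k = 0 then 2 * (Real.pi : ℂ) else 0 := by
  split_ifs with h
  · simp [h]
  · have hk : Complex.I * (k : ℂ) ≠ 0 := mul_ne_zero Complex.I_ne_zero (Int.cast_ne_zero.2 h)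
    rw [integral_exp_mul_complex hk]
    have : Complex.I * (k : ℂ) * ((2 * Real.pi : ℝ) : ℂ) = k * (2 * Real.pi * Complex.I) := by
      push_cast; ring
    rw [this, Complex.exp_int_mul_two_pi_mul_I]
    simp

/-- Parseval's identity for trigonometric polynomials. -/
theorem integral_norm_sq_trigPoly (a : ℕ → ℂ) (N : ℕ) :
    ∫ x in (0 : ℝ)..2 * Real.pi, ‖trigPoly a N x‖ ^ 2
      = 2 * Real.pi * ∑ n ∈ Finset.range N, ‖a n‖ ^ 2 := by
  have hexp : ∀ x : ℝ, ((‖trigPoly a N x‖ ^ 2 : ℝ) : ℂ)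
      = ∑ n ∈ Finset.range N, ∑ m ∈ Finset.range N,
        (starRingEnd ℂ (a n) * a m) * Complex.exp (Complex.I * ((n : ℤ) - m : ℤ) * x) := by
    intro x
    rw [Complex.ofReal_pow, ← Complex.conj_mul', trigPoly, map_sum, Finset.sum_mul_sum]
    refine Finset.sum_congr rfl fun n _ => Finset.sum_congr rfl fun m _ => ?_
    rw [map_mul, ← Complex.exp_conj, mul_mul_mul_comm, ← Complex.exp_add]
    congr 2
    simp
    ring
  have hint : ∀ n m : ℕ, IntervalIntegrable (fun x : ℝ =>
      (starRingEnd ℂ (a n) * a m) * Complex.exp (Complex.I * ((n : ℤ) - m : ℤ) * x))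
      volume 0 (2 * Real.pi) := fun n m => Continuous.intervalIntegrable (by fun_prop) _ _
  apply Complex.ofReal_injective
  rw [← intervalIntegral.integral_ofReal]
  simp_rw [hexp]
  rw [integral_finsetSum fun n _ =>
    Continuous.intervalIntegrable (by fun_prop) _ _]
  rw [Complex.ofReal_mul, Complex.ofReal_mul, Complex.ofReal_ofNat, Complex.ofReal_sum,
    Finset.mul_sum]
  refine Finset.sum_congr rfl fun n hn => ?_
  rw [integral_finsetSum fun m _ => hint n m, Finset.sum_eq_single n]
  · rw [intervalIntegral.integral_const_mul, integral_exp_int_mul, if_pos (sub_self _), Complex.conj_mul',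
      Complex.ofReal_pow]
    ring
  · intro m _ hm
    rw [intervalIntegral.integral_const_mul, integral_exp_int_mul, if_neg (by omega), mul_zero]
  · exact fun h => absurd hn h

/-- A one-dimensional Sobolev inequality: point values are controlled by the mean of the function
and the integral of a majorant of its derivative. -/
theorem le_average_add_integral {F F' G : ℝ → ℝ} {a b x : ℝ} (hab : a < b)
    (hx : x ∈ Set.Icc a b) (hF : ∀ y, HasDerivAt F (F' y) y) (hF' : Continuous F')
    (hG : Continuous G) (hFG : ∀ y, |F' y| ≤ G y) :
    F x ≤ (b - a)⁻¹ * (∫ y in a..b, F y) + ∫ y in a..b, G y := by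
  have hFc : Continuous F := continuous_iff_continuousAt.2 fun y => (hF y).continuousAt
  have hG0 : ∀ y, 0 ≤ G y := fun y => (abs_nonneg _).trans (hFG y)
  have key : ∀ y ∈ Set.Icc a b, F x - ∫ t in a..b, G t ≤ F y := by
    intro y hy
    have h1 : ∫ t in y..x, F' t = F x - F y :=
      integral_eq_sub_of_hasDerivAt (fun t _ => hF t) (hF'.intervalIntegrable _ _)
    have h2 : |∫ t in y..x, F' t| ≤ ∫ t in a..b, G t := by
      rw [← Real.norm_eq_abs]
      refine (norm_integral_le_integral_norm_uIoc).trans ?_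
      rw [integral_of_le hab.le]
      refine (setIntegral_mono_on (hF'.norm.integrableOn_uIoc) hG.integrableOn_uIoc
        measurableSet_uIoc fun t _ => hFG t).trans ?_
      refine setIntegral_mono_set hG.integrableOn_Ioc (Filter.Eventually.of_forall hG0) ?_
      refine (Set.Ioc_subset_Ioc ?_ ?_).eventuallyLE
      · exact le_min hy.1 hx.1
      · exact max_le hy.2 hx.2
    have := (le_abs_self _).trans h2
    linarith
  have hmono : ∫ _ in a..b, (F x - ∫ t in a..b, G t) ≤ ∫ y in a..b, F y :=
    integral_mono_on hab.le (by simp) (hFc.intervalIntegrable _ _) key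
  rw [intervalIntegral.integral_const, smul_eq_mul] at hmono
  have hpos : 0 < b - a := sub_pos.2 hab
  have := mul_le_mul_of_nonneg_left hmono (inv_nonneg.2 hpos.le)
  rw [← mul_assoc, inv_mul_cancel₀ hpos.ne', one_mul] at this
  linarith

/-- The majorant in the Sobolev inequality for `‖trigPoly a N‖ ^ 2` at scale `1 / N`. -/
noncomputable def sobolevDensity (a : ℕ → ℂ) (N : ℕ) (x : ℝ) : ℝ :=
  2 * N * ‖trigPoly a N x‖ ^ 2
    + (N : ℝ)⁻¹ * ‖trigPoly (fun n => -(Complex.I * n) * a n) N x‖ ^ 2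

theorem continuous_sobolevDensity (a : ℕ → ℂ) (N : ℕ) : Continuous (sobolevDensity a N) := by
  have h1 := continuous_trigPoly a N
  have h2 := continuous_trigPoly (fun n => -(Complex.I * n) * a n) N
  unfold sobolevDensity; fun_prop

/-- Parseval applied twice: differentiation costs at most `N²`, which the weight `1/N` reduces to
`N`. The constant is `2 · 2π + 2π`. -/
theorem integral_sobolevDensity_le (a : ℕ → ℂ) {N : ℕ} (hN : 0 < N) :
    ∫ x in (0 : ℝ)..2 * Real.pi, sobolevDensity a N x
      ≤ 6 * Real.pi * N * ∑ n ∈ Finset.range N, ‖a n‖ ^ 2 := by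
  have h1 := continuous_trigPoly a N
  have h2 := continuous_trigPoly (fun n => -(Complex.I * n) * a n) N
  have hN' : (0 : ℝ) < N := by exact_mod_cast hN
  have hb : ∑ n ∈ Finset.range N, ‖-(Complex.I * n) * a n‖ ^ 2
      ≤ (N : ℝ) ^ 2 * ∑ n ∈ Finset.range N, ‖a n‖ ^ 2 := by
    rw [Finset.mul_sum]
    refine Finset.sum_le_sum fun n hn => ?_
    rw [norm_mul, mul_pow]
    refine mul_le_mul_of_nonneg_right ?_ (by positivity)
    have : (n : ℝ) ≤ N := by exact_mod_cast (Finset.mem_range.1 hn).le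
    simpa using pow_le_pow_left₀ (by positivity) this 2
  unfold sobolevDensity
  rw [integral_add (Continuous.intervalIntegrable (by fun_prop) _ _)
    (Continuous.intervalIntegrable (by fun_prop) _ _), intervalIntegral.integral_const_mul,
    intervalIntegral.integral_const_mul,
    integral_norm_sq_trigPoly, integral_norm_sq_trigPoly]
  have h3 : (N : ℝ)⁻¹ * (2 * Real.pi * ∑ n ∈ Finset.range N, ‖-(Complex.I * n) * a n‖ ^ 2)
      ≤ (N : ℝ)⁻¹ * (2 * Real.pi * ((N : ℝ) ^ 2 * ∑ n ∈ Finset.range N, ‖a n‖ ^ 2)) := by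
    gcongr
  have h4 : (N : ℝ)⁻¹ * (2 * Real.pi * ((N : ℝ) ^ 2 * ∑ n ∈ Finset.range N, ‖a n‖ ^ 2))
      = 2 * Real.pi * N * ∑ n ∈ Finset.range N, ‖a n‖ ^ 2 := by
    field_simp
  linarith

theorem norm_sq_trigPoly_le (a : ℕ → ℂ) {N : ℕ} (hN : 0 < N) {l x : ℝ}
    (hx : x ∈ Set.Icc l (l + 2 * Real.pi / N)) :
    ‖trigPoly a N x‖ ^ 2 ≤ ∫ y in l..l + 2 * Real.pi / N, sobolevDensity a N y := by
  set b : ℕ → ℂ := fun n => -(Complex.I * n) * a n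
  have h1 := continuous_trigPoly a N
  have h2 := continuous_trigPoly b N
  have hN' : (0 : ℝ) < N := by exact_mod_cast hN
  have hpi := Real.pi_pos
  have hlen : 0 < 2 * Real.pi / N := by positivity
  have hd : ∀ y, HasDerivAt (fun y => ‖trigPoly a N y‖ ^ 2)
      (2 * inner ℝ (trigPoly a N y) (trigPoly b N y)) y := fun y =>
    (hasDerivAt_trigPoly a N y).norm_sq
  have hG : ∀ y, |2 * inner ℝ (trigPoly a N y) (trigPoly b N y)|
      ≤ N * ‖trigPoly a N y‖ ^ 2 + (N : ℝ)⁻¹ * ‖trigPoly b N y‖ ^ 2 := by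
    intro y
    have hin := abs_real_inner_le_norm (trigPoly a N y) (trigPoly b N y)
    rw [abs_mul, abs_two]
    -- AM-GM weighted by `N`, the size of a derivative relative to the polynomial.
    have hsq : 0 ≤ (N : ℝ)⁻¹ * (N * ‖trigPoly a N y‖ - ‖trigPoly b N y‖) ^ 2 := by positivity
    have he : (N : ℝ)⁻¹ * (N * ‖trigPoly a N y‖ - ‖trigPoly b N y‖) ^ 2
        = N * ‖trigPoly a N y‖ ^ 2 + (N : ℝ)⁻¹ * ‖trigPoly b N y‖ ^ 2
          - 2 * (‖trigPoly a N y‖ * ‖trigPoly b N y‖) := by field_simp; ring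
    linarith
  have hS := le_average_add_integral (by linarith) hx hd (by fun_prop) (by fun_prop) hG
  refine hS.trans ?_
  rw [add_sub_cancel_left, ← intervalIntegral.integral_const_mul, ← integral_add
    (Continuous.intervalIntegrable (by fun_prop) _ _)
    (Continuous.intervalIntegrable (by fun_prop) _ _)]
  refine integral_mono_on (by linarith) (Continuous.intervalIntegrable (by fun_prop) _ _)
    ((continuous_sobolevDensity a N).intervalIntegrable _ _) fun y _ => ?_
  -- The averaging term costs `N/(2π) ≤ N`; with the `N` from the derivative term this makes the `2
  -- * N` in `sobolevDensity`.
  have hinv : (2 * Real.pi / (N : ℝ))⁻¹ ≤ N := by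
    rw [inv_div, div_le_iff₀ (by positivity)]
    nlinarith [Real.pi_gt_three]
  have := mul_le_mul_of_nonneg_right hinv (sq_nonneg ‖trigPoly a N y‖)
  simp only [sobolevDensity]
  linarith

theorem setLIntegral_biUnion_finset_le {X ι : Type*} [MeasurableSpace X] (μ : Measure X)
    (t : Finset ι) (J : ι → Set X) (f : X → ENNReal) :
    ∫⁻ x in ⋃ j ∈ t, J j, f x ∂μ ≤ ∑ j ∈ t, ∫⁻ x in J j, f x ∂μ := by
  classical
  induction t using Finset.induction_on with
  | empty => simp
  | insert j t hj ih =>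
    rw [Finset.set_biUnion_insert, Finset.sum_insert hj]
    exact (lintegral_union_le _ _ _).trans (add_le_add le_rfl ih)

/-- The `L²(ν)` bound for trigonometric polynomials of degree less than `N`, for a measure `ν`
giving mass at most `M` to each interval of length `2π / N`. -/
theorem lintegral_norm_sq_trigPoly_le (ν : Measure ℝ)
    (hν : ν (Set.Ioo 0 (2 * Real.pi))ᶜ = 0) (a : ℕ → ℂ) {N : ℕ} (hN : 0 < N) {M : ℝ}
    (hM0 : 0 ≤ M) (hM : ∀ j < N, ν (Set.Icc (j * (2 * Real.pi / N)) ((j + 1) * (2 * Real.pi / N))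
      ∩ Set.Ioo 0 (2 * Real.pi)) ≤ ENNReal.ofReal M) :
    ∫⁻ x, ENNReal.ofReal (‖trigPoly a N x‖ ^ 2) ∂ν
      ≤ ENNReal.ofReal (M * (6 * Real.pi * N * ∑ n ∈ Finset.range N, ‖a n‖ ^ 2)) := by
  have hN' : (0 : ℝ) < N := by exact_mod_cast hN
  have hpi := Real.pi_pos
  set h := 2 * Real.pi / (N : ℝ) with hh
  have hpos : 0 < h := by positivity
  set J : ℕ → Set ℝ := fun j => Set.Icc (j * h) ((j + 1) * h) ∩ Set.Ioo 0 (2 * Real.pi)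
  have hcover : Set.Ioo 0 (2 * Real.pi) ⊆ ⋃ j ∈ Finset.range N, J j := by
    intro x hx
    have hxh : 0 ≤ x / h := (div_pos hx.1 hpos).le
    refine Set.mem_biUnion (x := ⌊x / h⌋₊) ?_ ⟨⟨?_, ?_⟩, hx⟩
    · rw [Finset.mem_coe, Finset.mem_range, Nat.floor_lt hxh, div_lt_iff₀ hpos, hh,
        mul_div_cancel₀ _ hN'.ne']
      exact hx.2
    · exact (le_div_iff₀ hpos).1 (Nat.floor_le hxh)
    · exact ((div_lt_iff₀ hpos).1 (Nat.lt_floor_add_one _)).le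
  have hS0 : ∀ y, 0 ≤ sobolevDensity a N y := fun y => by unfold sobolevDensity; positivity
  have hI0 : ∀ j : ℕ, 0 ≤ ∫ y in (j * h)..((j + 1) * h), sobolevDensity a N y := fun j =>
    integral_nonneg (by nlinarith) fun y _ => hS0 y
  have hae : ν = ν.restrict (Set.Ioo 0 (2 * Real.pi)) := by
    rw [Measure.restrict_eq_self_of_ae_mem]
    exact hν
  calc ∫⁻ x, ENNReal.ofReal (‖trigPoly a N x‖ ^ 2) ∂ν
      = ∫⁻ x in Set.Ioo 0 (2 * Real.pi), ENNReal.ofReal (‖trigPoly a N x‖ ^ 2) ∂ν := by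
        rw [← hae]
    _ ≤ ∫⁻ x in ⋃ j ∈ Finset.range N, J j, ENNReal.ofReal (‖trigPoly a N x‖ ^ 2) ∂ν :=
        lintegral_mono_set hcover
    _ ≤ ∑ j ∈ Finset.range N, ∫⁻ x in J j, ENNReal.ofReal (‖trigPoly a N x‖ ^ 2) ∂ν :=
        setLIntegral_biUnion_finset_le ν _ _ _
    _ ≤ ∑ j ∈ Finset.range N,
          ENNReal.ofReal (M * ∫ y in (j * h)..((j + 1) * h), sobolevDensity a N y) := by
        refine Finset.sum_le_sum fun j hj => ?_
        have hJ : MeasurableSet (J j) := measurableSet_Icc.inter measurableSet_Ioo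
        refine (setLIntegral_mono' (g := fun _ => ENNReal.ofReal
          (∫ y in (j * h)..((j + 1) * h), sobolevDensity a N y)) hJ fun x hx => ?_).trans ?_
        · refine ENNReal.ofReal_le_ofReal ?_
          have e : ((j : ℝ) + 1) * h = j * h + h := by ring
          rw [e]
          exact norm_sq_trigPoly_le a hN (by rw [← hh, ← e]; exact hx.1)
        · rw [setLIntegral_const, mul_comm, ENNReal.ofReal_mul hM0]
          exact mul_le_mul_left (hM j (Finset.mem_range.1 hj)) _
    _ = ENNReal.ofReal (M * ∫ y in (0 : ℝ)..2 * Real.pi, sobolevDensity a N y) := by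
        rw [← ENNReal.ofReal_sum_of_nonneg fun j _ => mul_nonneg hM0 (hI0 j), ← Finset.mul_sum]
        have hadj := sum_integral_adjacent_intervals (f := sobolevDensity a N) (μ := volume)
          (a := fun j : ℕ => (j : ℝ) * h) (n := N)
          fun k _ => (continuous_sobolevDensity a N).intervalIntegrable _ _
        have hNh : (N : ℝ) * h = 2 * Real.pi := by rw [hh, mul_div_cancel₀ _ hN'.ne']
        simp only [Nat.cast_add, Nat.cast_one, Nat.cast_zero, zero_mul, hNh] at hadj
        rw [hadj]
    _ ≤ _ := ENNReal.ofReal_le_ofReal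
        (mul_le_mul_of_nonneg_left (integral_sobolevDensity_le a hN) hM0)

end TrigPoly

end OPUC

namespace OPUC

/-! ### Expected size of block sums and dyadic energies. -/

section Blocks

open MeasureTheory

theorem norm_blockSum_pruferCoeff (α : ℕ → ℂ) (η : ℝ) (s N : ℕ) :
    ‖blockSum (pruferCoeff α η) s N‖
      = ‖trigPoly (fun n => starRingEnd ℂ (α (s + n))) N η‖ := by
  have hw : ‖Complex.exp (-(Complex.I * η))‖ = 1 := by
    have := Complex.norm_exp_ofReal_mul_I (-η)
    rwa [Complex.ofReal_neg, neg_mul, mul_comm] at this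
  have h : blockSum (pruferCoeff α η) s N = -(Complex.exp (-(Complex.I * η)) ^ (s + 1)
      * trigPoly (fun n => starRingEnd ℂ (α (s + n))) N η) := by
    rw [blockSum, trigPoly, Finset.mul_sum, ← Finset.sum_neg_distrib]
    refine Finset.sum_congr rfl fun n _ => ?_
    have e : Complex.exp (-(Complex.I * n) * η) = Complex.exp (-(Complex.I * η)) ^ n := by
      rw [← Complex.exp_nat_mul]; ring_nf
    rw [pruferCoeff, e]
    ring
  rw [h, norm_neg, norm_mul, norm_pow, hw, one_pow, one_mul]

theorem continuous_blockSum_pruferCoeff (α : ℕ → ℂ) (s N : ℕ) :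
    Continuous fun η => blockSum (pruferCoeff α η) s N := by
  unfold blockSum pruferCoeff; fun_prop

theorem continuous_dyadicEnergy_pruferCoeff (α : ℕ → ℂ) (m s : ℕ) :
    Continuous fun η => dyadicEnergy (pruferCoeff α η) m s := by
  induction m generalizing s with
  | zero => exact continuous_const
  | succ m ih =>
    have h1 := continuous_blockSum_pruferCoeff α s (2 ^ m)
    have h2 := continuous_blockSum_pruferCoeff α (s + 2 ^ m) (2 ^ m)
    have h3 := ih s
    have h4 := ih (s + 2 ^ m)
    simp only [dyadicEnergy]
    fun_prop

theorem blockSum_norm_sq_nonneg (α : ℕ → ℂ) (s N : ℕ) :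
    0 ≤ blockSum (fun n => ‖α n‖ ^ 2) s N :=
  Finset.sum_nonneg fun _ _ => by positivity

/-- An interval of length `2π/N` has mass `O(N^{-D})`, against the factor `N` lost in the Sobolev
inequality. -/
theorem exists_lintegral_norm_sq_blockSum_le (α : ℕ → ℂ) (ν : Measure ℝ)
    (hν : ν (Set.Ioo 0 (2 * Real.pi))ᶜ = 0) {D : ℝ} (hD : 0 ≤ D) {C : NNReal}
    (hC : ∀ I : Set ℝ, I.OrdConnected → I ⊆ Set.Ioo 0 (2 * Real.pi) →
      ν I ≤ (C : ENNReal) * volume I ^ D) :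
    ∃ K : ℝ, 0 ≤ K ∧ ∀ s N : ℕ, 0 < N →
      ∫⁻ η, ENNReal.ofReal (‖blockSum (pruferCoeff α η) s N‖ ^ 2) ∂ν
        ≤ ENNReal.ofReal (K * (N : ℝ) ^ (1 - D) * blockSum (fun n => ‖α n‖ ^ 2) s N) := by
  have hpi := Real.pi_pos
  refine ⟨C * (2 * Real.pi) ^ D * (6 * Real.pi), by positivity, fun s N hN => ?_⟩
  have hN' : (0 : ℝ) < N := by exact_mod_cast hN
  have hM : ∀ j < N, ν (Set.Icc (j * (2 * Real.pi / N)) ((j + 1) * (2 * Real.pi / N))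
      ∩ Set.Ioo 0 (2 * Real.pi)) ≤ ENNReal.ofReal (C * (2 * Real.pi / N) ^ D) := by
    intro j _
    refine (hC _ (Set.ordConnected_Icc.inter Set.ordConnected_Ioo)
      Set.inter_subset_right).trans ?_
    rw [ENNReal.ofReal_mul C.coe_nonneg, ENNReal.ofReal_coe_nnreal,
      ← ENNReal.ofReal_rpow_of_nonneg (by positivity) hD]
    gcongr
    refine (measure_mono Set.inter_subset_left).trans ?_
    rw [Real.volume_Icc]
    exact ENNReal.ofReal_le_ofReal (by linarith)
  have h := lintegral_norm_sq_trigPoly_le ν hν (fun n => starRingEnd ℂ (α (s + n))) hN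
    (by positivity) hM
  simp_rw [norm_blockSum_pruferCoeff]
  refine h.trans (le_of_eq ?_)
  congr 1
  simp only [RCLike.norm_conj, blockSum]
  rw [Real.div_rpow (by positivity) hN'.le, Real.rpow_sub hN', Real.rpow_one]
  ring

/-- Each of the `m` proper dyadic levels partitions the block, so it contributes the full `∑
|α_j|²`, with scale factor at most `(2^m)^(1-D)` because `D ≤ 1`. -/
theorem lintegral_dyadicEnergy_le (α : ℕ → ℂ) (ν : Measure ℝ) {D K : ℝ} (hD : D ≤ 1)
    (hK : 0 ≤ K) (h : ∀ s N : ℕ, 0 < N →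
      ∫⁻ η, ENNReal.ofReal (‖blockSum (pruferCoeff α η) s N‖ ^ 2) ∂ν
        ≤ ENNReal.ofReal (K * (N : ℝ) ^ (1 - D) * blockSum (fun n => ‖α n‖ ^ 2) s N))
    (m s : ℕ) :
    ∫⁻ η, ENNReal.ofReal (dyadicEnergy (pruferCoeff α η) m s) ∂ν
      ≤ ENNReal.ofReal (m * (K * ((2 : ℝ) ^ m) ^ (1 - D)
        * blockSum (fun n => ‖α n‖ ^ 2) s (2 ^ m))) := by
  induction m generalizing s with
  | zero => simp [dyadicEnergy]
  | succ m ih =>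
    have c1 := (continuous_blockSum_pruferCoeff α s (2 ^ m)).measurable
    have c2 := (continuous_blockSum_pruferCoeff α (s + 2 ^ m) (2 ^ m)).measurable
    have c3 := (continuous_dyadicEnergy_pruferCoeff α m s).measurable
    have c4 := (continuous_dyadicEnergy_pruferCoeff α m (s + 2 ^ m)).measurable
    have w1 := blockSum_norm_sq_nonneg α s (2 ^ m)
    have w2 := blockSum_norm_sq_nonneg α (s + 2 ^ m) (2 ^ m)
    have i1 := h s (2 ^ m) (by positivity)
    have i2 := h (s + 2 ^ m) (2 ^ m) (by positivity)
    have i3 := ih s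
    have i4 := ih (s + 2 ^ m)
    push_cast at i1 i2
    have hmono : ((2 : ℝ) ^ m) ^ (1 - D) ≤ ((2 : ℝ) ^ (m + 1)) ^ (1 - D) :=
      Real.rpow_le_rpow (by positivity) (pow_le_pow_right₀ one_le_two m.le_succ) (by linarith)
    have hsplit : ∀ η, ENNReal.ofReal (dyadicEnergy (pruferCoeff α η) (m + 1) s)
        = ENNReal.ofReal (‖blockSum (pruferCoeff α η) s (2 ^ m)‖ ^ 2)
          + ENNReal.ofReal (‖blockSum (pruferCoeff α η) (s + 2 ^ m) (2 ^ m)‖ ^ 2)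
          + ENNReal.ofReal (dyadicEnergy (pruferCoeff α η) m s)
          + ENNReal.ofReal (dyadicEnergy (pruferCoeff α η) m (s + 2 ^ m)) := by
      intro η
      have e1 := dyadicEnergy_nonneg (pruferCoeff α η) m s
      have e2 := dyadicEnergy_nonneg (pruferCoeff α η) m (s + 2 ^ m)
      rw [← ENNReal.ofReal_add (by positivity) (by positivity),
        ← ENNReal.ofReal_add (by positivity) e1, ← ENNReal.ofReal_add (by positivity) e2]
      rfl
    simp_rw [hsplit]
    rw [lintegral_add_left (by fun_prop), lintegral_add_left (by fun_prop),
      lintegral_add_left (by fun_prop)]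
    refine (add_le_add (add_le_add (add_le_add i1 i2) i3) i4).trans ?_
    rw [← ENNReal.ofReal_add (by positivity) (by positivity),
      ← ENNReal.ofReal_add (by positivity) (by positivity),
      ← ENNReal.ofReal_add (by positivity) (by positivity)]
    refine ENNReal.ofReal_le_ofReal ?_
    have hadd : blockSum (fun n => ‖α n‖ ^ 2) s (2 ^ (m + 1))
        = blockSum (fun n => ‖α n‖ ^ 2) s (2 ^ m)
          + blockSum (fun n => ‖α n‖ ^ 2) (s + 2 ^ m) (2 ^ m) := by
      rw [pow_succ, mul_two, blockSum_add]
    rw [hadd]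
    push_cast
    calc _ = ((m : ℝ) + 1) * (K * ((2 : ℝ) ^ m) ^ (1 - D)
          * (blockSum (fun n => ‖α n‖ ^ 2) s (2 ^ m)
            + blockSum (fun n => ‖α n‖ ^ 2) (s + 2 ^ m) (2 ^ m))) := by ring
      _ ≤ _ := by gcongr

theorem blockSum_norm_sq_le {α : ℕ → ℂ} {γ : ℝ} (hγ : 0 ≤ γ)
    (hsum : Summable fun n : ℕ => (n : ℝ) ^ γ * ‖α n‖ ^ 2) {s : ℕ} (hs : 0 < s) (N : ℕ) :
    blockSum (fun n => ‖α n‖ ^ 2) s N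
      ≤ (s : ℝ) ^ (-γ) * ∑' n : ℕ, (n : ℝ) ^ γ * ‖α n‖ ^ 2 := by
  have hs' : (0 : ℝ) < s := by exact_mod_cast hs
  have h1 : (s : ℝ) ^ γ * blockSum (fun n => ‖α n‖ ^ 2) s N
      ≤ ∑' n : ℕ, (n : ℝ) ^ γ * ‖α n‖ ^ 2 := by
    rw [blockSum, Finset.mul_sum]
    have hinj : Function.Injective fun i : ℕ => s + i := fun i j h => by simpa using h
    calc ∑ i ∈ Finset.range N, (s : ℝ) ^ γ * ‖α (s + i)‖ ^ 2
        ≤ ∑ i ∈ Finset.range N, ((s + i : ℕ) : ℝ) ^ γ * ‖α (s + i)‖ ^ 2 := by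
          refine Finset.sum_le_sum fun i _ => mul_le_mul_of_nonneg_right ?_ (by positivity)
          exact Real.rpow_le_rpow hs'.le (by push_cast; linarith [Nat.cast_nonneg (α := ℝ) i]) hγ
      _ = ∑ n ∈ (Finset.range N).map ⟨_, hinj⟩, (n : ℝ) ^ γ * ‖α n‖ ^ 2 := by
          rw [Finset.sum_map]; rfl
      _ ≤ _ := hsum.sum_le_tsum _ fun n _ => by positivity
  rw [Real.rpow_neg hs'.le]
  have := mul_le_mul_of_nonneg_left h1 (inv_nonneg.2 (Real.rpow_nonneg hs'.le γ))
  rwa [← mul_assoc, inv_mul_cancel₀ (Real.rpow_pos_of_pos hs' γ).ne', one_mul] at this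

/-! ### Almost everywhere geometric decay and boundedness of the products. -/

theorem summable_add_one_mul_geometric {q : ℝ} (hq0 : 0 ≤ q) (hq1 : q < 1) :
    Summable fun k : ℕ => ((k : ℝ) + 1) * q ^ k := by
  have hq : ‖q‖ < 1 := by rwa [Real.norm_of_nonneg hq0]
  have h := (summable_pow_mul_geometric_of_norm_lt_one 1 hq).add
    (summable_geometric_of_norm_lt_one hq)
  exact h.congr fun k => by ring

/-- If the integrals of nonnegative functions decay like `(k + 1) q ^ (2 k)` then the functions
are almost everywhere `O(q ^ k)`. -/
theorem ae_exists_forall_le_mul_pow {X : Type*} [MeasurableSpace X] (μ : Measure X)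
    {g : ℕ → X → ℝ} (hg : ∀ k, Measurable (g k)) {q A : ℝ} (hq0 : 0 < q) (hq1 : q < 1)
    (hA : 0 ≤ A) (h : ∀ k : ℕ, ∫⁻ x, ENNReal.ofReal (g k x) ∂μ
      ≤ ENNReal.ofReal (((k : ℝ) + 1) * A * (q ^ k * q ^ k))) :
    ∀ᵐ x ∂μ, ∃ c : ℝ, 0 ≤ c ∧ ∀ k, g k x ≤ c * q ^ k := by
  have hsum : Summable fun k : ℕ => A * (((k : ℝ) + 1) * q ^ k) :=
    (summable_add_one_mul_geometric hq0.le hq1).mul_left A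
  -- Weighting by `q^{-k}` spends one of the two factors `q^k`; the other makes the sum of the
  -- integrals converge.
  have hfin : ∫⁻ x, ∑' k, ENNReal.ofReal ((q ^ k)⁻¹ * g k x) ∂μ ≠ ⊤ := by
    rw [lintegral_tsum fun k => by fun_prop]
    refine ne_top_of_le_ne_top ?_ (ENNReal.tsum_le_tsum (g := fun k : ℕ =>
      ENNReal.ofReal (A * (((k : ℝ) + 1) * q ^ k))) fun k => ?_)
    · rw [← ENNReal.ofReal_tsum_of_nonneg (fun k => by positivity) hsum]
      exact ENNReal.ofReal_ne_top
    · have hqk : (0 : ℝ) < q ^ k := pow_pos hq0 k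
      simp_rw [ENNReal.ofReal_mul (inv_nonneg.2 hqk.le)]
      rw [lintegral_const_mul _ (by fun_prop)]
      refine (mul_le_mul_right (h k) _).trans ?_
      rw [← ENNReal.ofReal_mul (inv_nonneg.2 hqk.le)]
      refine ENNReal.ofReal_le_ofReal (le_of_eq ?_)
      field_simp
  filter_upwards [ae_lt_top (Measurable.tsum fun k => by fun_prop) hfin] with x hx
  refine ⟨(∑' k, ENNReal.ofReal ((q ^ k)⁻¹ * g k x)).toReal, ENNReal.toReal_nonneg, fun k => ?_⟩
  have hqk : (0 : ℝ) < q ^ k := pow_pos hq0 k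
  have h1 := (ENNReal.ofReal_le_iff_le_toReal hx.ne).1 (ENNReal.le_tsum k)
  rwa [inv_mul_le_iff₀ hqk, mul_comm] at h1

/-- Geometric decay of the dyadic energies makes the block products summably close to `1`. -/
theorem summable_norm_orderedProd_sub_one {𝔸 : Type*} [NormedRing 𝔸] (B : ℕ → 𝔸) {q c : ℝ}
    (hq0 : 0 ≤ q) (hq1 : q < 1) (hc : 0 ≤ c)
    (h : ∀ k, ‖blockSum B (2 ^ k) (2 ^ k)‖ ^ 2 + dyadicEnergy B k (2 ^ k) ≤ c * q ^ k) :
    Summable fun k => ‖orderedProd B (2 ^ k) (2 ^ k) - 1‖ := by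
  have hs : √q < 1 := by rw [Real.sqrt_lt' one_pos]; simpa using hq1
  have hsum : Summable fun k : ℕ => √c * √q ^ k + 3 * c * q ^ k :=
    ((summable_geometric_of_lt_one (Real.sqrt_nonneg q) hs).mul_left _).add
      ((summable_geometric_of_lt_one hq0 hq1).mul_left _)
  refine Summable.of_norm_bounded_eventually_nat hsum ?_
  -- Geometric decay eventually beats the threshold `1/(k+1)` required of the energy; finitely many
  -- blocks do not affect summability.
  have htend := ((summable_add_one_mul_geometric hq0 hq1).mul_left (3 * c)).tendsto_atTop_zero
  filter_upwards [htend.eventually_le_const one_pos] with k hk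
  have hE := dyadicEnergy_nonneg B k (2 ^ k)
  have hb := sq_nonneg ‖blockSum B (2 ^ k) (2 ^ k)‖
  have hEk : dyadicEnergy B k (2 ^ k) ≤ c * q ^ k := by linarith [h k]
  have hsmall : 3 * dyadicEnergy B k (2 ^ k) ≤ 1 / ((k : ℝ) + 1) := by
    rw [le_div_iff₀ (by positivity)]
    have := mul_le_mul_of_nonneg_right hEk (by positivity : (0 : ℝ) ≤ (k : ℝ) + 1)
    linarith
  have hbk : ‖blockSum B (2 ^ k) (2 ^ k)‖ ≤ √c * √q ^ k := by
    refine le_of_sq_le_sq ?_ (by positivity)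
    rw [mul_pow, Real.sq_sqrt hc, ← pow_mul, mul_comm k 2, pow_mul, Real.sq_sqrt hq0]
    linarith [h k]
  rw [norm_norm]
  linarith [norm_orderedProd_sub_one_le B k (2 ^ k) hsmall]

theorem blockEndpoint_eq_zero_or_two_pow (α : ℕ → ℂ) (hα : {n | α n ≠ 0}.Infinite) (n : ℕ) :
    blockEndpoint α n = 0 ∨ ∃ k : ℕ, blockEndpoint α n = 2 ^ k := by
  cases n with
  | zero => exact Or.inl rfl
  | succ n => exact Or.inr (blockEndpoint_isLeast α hα n).1.1

/-- Almost everywhere the transfer operators are bounded along the powers of two. -/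
theorem ae_bounded_orderedProd_pruferStep {γ : ℝ} (hγ : 0 ≤ γ) (α : ℕ → ℂ)
    (hsum : Summable fun n : ℕ => (n : ℝ) ^ γ * ‖α n‖ ^ 2) (ν : Measure ℝ)
    (hν : ν (Set.Ioo 0 (2 * Real.pi))ᶜ = 0) {D : ℝ} (hD0 : 0 ≤ D) (hD1 : D ≤ 1)
    (hγD : 1 - γ < D) {C : NNReal}
    (hC : ∀ I : Set ℝ, I.OrdConnected → I ⊆ Set.Ioo 0 (2 * Real.pi) →
      ν I ≤ (C : ENNReal) * volume I ^ D) :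
    ∀ᵐ η ∂ν, ∃ c : ℝ, ∀ k : ℕ, ‖orderedProd (pruferStep α η) 0 (2 ^ k)‖ ≤ c := by
  obtain ⟨K, hK, hblock⟩ := exists_lintegral_norm_sq_blockSum_le α ν hν hD0 hC
  set S := ∑' n : ℕ, (n : ℝ) ^ γ * ‖α n‖ ^ 2
  have hS : 0 ≤ S := tsum_nonneg fun n => by positivity
  -- Half the decay exponent, so that the expected energy is of order `(k+1) q^k q^k`.
  set q : ℝ := 2 ^ (-((D + γ - 1) / 2)) with hq
  have hq0 : 0 < q := by positivity
  have hq1 : q < 1 := Real.rpow_lt_one_of_one_lt_of_neg one_lt_two (by linarith)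
  have hpow : ∀ k : ℕ, ((2 : ℝ) ^ k) ^ (1 - D) * ((2 : ℝ) ^ k) ^ (-γ) = q ^ k * q ^ k := by
    intro k
    rw [← Real.rpow_add (by positivity), hq, ← Real.rpow_natCast, ← Real.rpow_natCast,
      ← Real.rpow_mul zero_le_two, ← Real.rpow_mul zero_le_two, ← Real.rpow_add two_pos]
    ring_nf
  have hae := ae_exists_forall_le_mul_pow ν
    (g := fun k η => ‖blockSum (pruferCoeff α η) (2 ^ k) (2 ^ k)‖ ^ 2
      + dyadicEnergy (pruferCoeff α η) k (2 ^ k))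
    (fun k => (((continuous_blockSum_pruferCoeff α _ _).norm.pow 2).add
      (continuous_dyadicEnergy_pruferCoeff α _ _)).measurable)
    hq0 hq1 (mul_nonneg hK hS) fun k => by
      have c1 := (continuous_blockSum_pruferCoeff α (2 ^ k) (2 ^ k)).measurable
      have hW := blockSum_norm_sq_nonneg α (2 ^ k) (2 ^ k)
      have hW' := blockSum_norm_sq_le hγ hsum (s := 2 ^ k) (by positivity) (2 ^ k)
      have i1 := hblock (2 ^ k) (2 ^ k) (by positivity)
      have i2 := lintegral_dyadicEnergy_le α ν hD1 hK hblock k (2 ^ k)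
      push_cast at i1 hW'
      simp_rw [fun η => ENNReal.ofReal_add (sq_nonneg ‖blockSum (pruferCoeff α η) (2 ^ k) (2 ^ k)‖)
        (dyadicEnergy_nonneg (pruferCoeff α η) k (2 ^ k))]
      rw [lintegral_add_left (by fun_prop)]
      refine (add_le_add i1 i2).trans ?_
      rw [← ENNReal.ofReal_add (by positivity) (by positivity)]
      refine ENNReal.ofReal_le_ofReal ?_
      rw [← hpow]
      calc _ = ((k : ℝ) + 1) * (K * ((2 : ℝ) ^ k) ^ (1 - D)
            * blockSum (fun n => ‖α n‖ ^ 2) (2 ^ k) (2 ^ k)) := by ring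
        _ ≤ ((k : ℝ) + 1) * (K * ((2 : ℝ) ^ k) ^ (1 - D) * (((2 : ℝ) ^ k) ^ (-γ) * S)) := by
            gcongr
        _ = _ := by ring
  filter_upwards [hae] with η hη
  obtain ⟨c, hc, hle⟩ := hη
  refine bddAbove_norm_of_summable_norm_sub_one _
    (fun k => orderedProd (pruferStep α η) (2 ^ k) (2 ^ k)) (fun k => ?_)
    (summable_norm_orderedProd_sub_one _ hq0.le hq1 hc fun k => ?_)
  · rw [pow_succ, mul_two, orderedProd_add, zero_add]
  · rw [norm_blockSum_pruferStep, dyadicEnergy_pruferStep]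
    exact hle k

end Blocks

end OPUC

theorem proposition4p3
    (γ : ℝ) (hγ : γ ∈ Set.Ioo (0 : ℝ) 1)
    (α : ℕ → ℂ) (hα : ∀ n, ‖α n‖ < 1)
    (hα_supp : {n | α n ≠ 0}.Infinite)
    (hα_sum : Summable (fun n : ℕ => (n : ℝ) ^ γ * ‖α n‖ ^ 2))
    (ν : MeasureTheory.Measure ℝ) [MeasureTheory.IsFiniteMeasure ν]
    (hν_supp : ∃ δ : ℝ, 0 < δ ∧ ν (Set.Ioo δ (2 * Real.pi - δ))ᶜ = 0)
    (hν_holder : ∃ D ∈ Set.Ioo (1 - γ) 1, ∃ C : NNReal,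
      ∀ I : Set ℝ, I.OrdConnected → I ⊆ Set.Ioo 0 (2 * Real.pi) →
        ν I ≤ (C : ENNReal) * MeasureTheory.volume I ^ D) :
    ∀ᵐ η ∂ν, BddAbove {r : ℝ | ∃ β ∈ Set.Ico (0 : ℝ) (2 * Real.pi), ∃ n : ℕ,
      r = OPUC.pruferRadius α (OPUC.blockEndpoint α n) η β} := by
  obtain ⟨δ, hδ, hν⟩ := hν_supp
  obtain ⟨D, hD, C, hC⟩ := hν_holder
  have hν' : ν (Set.Ioo 0 (2 * Real.pi))ᶜ = 0 :=
    MeasureTheory.measure_mono_null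
      (Set.compl_subset_compl.2 (Set.Ioo_subset_Ioo hδ.le (by linarith))) hν
  have hD0 : 0 ≤ D := by linarith [hD.1, hγ.2]
  filter_upwards [OPUC.ae_bounded_orderedProd_pruferStep hγ.1.le α hα_sum ν hν' hD0 hD.2.le hD.1 hC]
    with η hη
  obtain ⟨c, hc⟩ := hη
  -- The second term covers the endpoint `0`, which is not a power of two.
  refine ⟨max c ‖OPUC.orderedProd (OPUC.pruferStep α η) 0 0‖, ?_⟩
  rintro r ⟨β, -, n, rfl⟩
  refine (OPUC.pruferRadius_le α _ η β).trans ?_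
  rcases OPUC.blockEndpoint_eq_zero_or_two_pow α hα_supp n with h | ⟨k, h⟩
  · rw [h]; exact le_max_right _ _
  · rw [h]; exact (hc k).trans (le_max_left _ _)
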